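/- Let $A=C[0,1]$ be the $C^*$-algebra of continuous complex-valued functions on $[0,1]$. For a closed submodule $M$ of a Hilbert $C^*$-module $N$ over $A$, say that $M$ is *thick* in $N$ if $M^\perp:=\{n\in N:\langle n,m\rangle=0\ \text{for all } m\in M\}=\{0\}$. Then there exist a Hilbert $C^*$-module $N$ over $A$ and closed submodules $K\subset M\subset N$ such that $K$ is thick in the Hilbert $C^*$-module $M$ (with the inner product restricted from $N$), $M$ is thick in $N$, but $K$ is not thick in $N$. -/

import Mathlib

open scoped ComplexOrder

namespace HilbertModule

variable {A N : Type*} [CommCStarAlgebra A] [PartialOrder A]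
  [NormedAddCommGroup N] [NormedSpace ℂ N] [Module A N] [IsScalarTower ℂ A N] [CStarModule A N]

/-- A submodule of a Hilbert `A`-module carries the restricted operations, inner product and norm.
As `A` is commutative, left and right `A`-modules agree. -/
instance instCStarModuleSubmodule (M : Submodule A N) : CStarModule A M where
  inner x y := inner A (x : N) (y : N)
  inner_add_right := CStarModule.inner_add_right
  inner_self_nonneg := CStarModule.inner_self_nonneg
  inner_self {x} := by simp [CStarModule.inner_self]
  inner_op_smul_right := CStarModule.inner_op_smul_right
  inner_smul_right_complex := CStarModule.inner_smul_right_complex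
  star_inner x y := CStarModule.star_inner (x : N) (y : N)
  norm_eq_sqrt_norm_inner_self x := CStarModule.norm_eq_sqrt_norm_inner_self (x : N)

/-- The orthogonal complement `M^⊥ = {n ∈ N : ⟨n, m⟩ = 0 for all m ∈ M}`. -/
def orthogonalComplement (M : Submodule A N) : Set N :=
  {n | ∀ m ∈ M, inner A n m = 0}

/-- `M` is thick in `N` if `M^⊥ = 0`. -/
def IsThick (M : Submodule A N) : Prop :=
  orthogonalComplement M = {0}

end HilbertModule

/-! Take `N = C(I, ℓ²)` and a vector field `v` whose coordinates are continuous, while no continuous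
multiple `c • v` is norm continuous unless `c = 0` (`eq_zero_of_weight_mul`). Let `M` be the
sections pointwise orthogonal to `v`. Anything orthogonal to `M` is a continuous multiple of `v`,
hence zero, so `M` is thick. Let `K` be the sections in `M` whose `Sum.inl false` coordinate
vanishes: the constant basis section `e` lies in `K^⊥`. If `n ∈ M` is orthogonal to `K`, the same
rigidity leaves only its `e` component, and `n ⊥ v` kills that because `v` has `e`-coordinate 1. -/

namespace HilbertModule

open Filter Topology unitInterval

/-! ### Continuous Hilbert-space-valued functions as a Hilbert module -/

section ContinuousMapModule

variable {X H : Type*} [TopologicalSpace X]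
  [NormedAddCommGroup H] [InnerProductSpace ℂ H]

instance instIsScalarTowerContinuousMap : IsScalarTower ℂ C(X, ℂ) C(X, H) where
  smul_assoc z a x := by
    ext t
    simp [mul_smul]

/-- The Hilbert `C(X)`-module of continuous functions on a compact space `X` with values in an
inner product space, with the pointwise inner product. -/
noncomputable instance instCStarModuleContinuousMap [CompactSpace X] : CStarModule C(X, ℂ) C(X, H) where
  inner x y := ⟨fun t => inner ℂ (x t) (y t), by fun_prop⟩
  inner_add_right := by
    intro x y z
    ext t
    simp
  inner_self_nonneg := by
    intro x
    rw [ContinuousMap.le_def]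
    intro t
    simp only [ContinuousMap.coe_zero, Pi.zero_apply, ContinuousMap.coe_mk,
      inner_self_eq_norm_sq_to_K]
    rw [← RCLike.ofReal_pow]
    exact Complex.zero_le_real.2 (sq_nonneg ‖x t‖)
  inner_self := by
    intro x
    simp [ContinuousMap.ext_iff]
  inner_op_smul_right := by
    intro a x y
    ext t
    simp
  inner_smul_right_complex := by
    intro z x y
    ext t
    simp
  star_inner x y := by
    ext t
    simp
  norm_eq_sqrt_norm_inner_self x := by
    symm
    rw [Real.sqrt_eq_iff_mul_self_eq (norm_nonneg _) (norm_nonneg _)]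
    apply le_antisymm
    · rw [ContinuousMap.norm_le _ (by positivity)]
      intro t
      have h := ContinuousMap.norm_coe_le_norm x t
      calc ‖inner ℂ (x t) (x t)‖ ≤ ‖x t‖ * ‖x t‖ := norm_inner_le_norm _ _
        _ ≤ ‖x‖ * ‖x‖ := by gcongr
    · have h : ‖x‖ ≤ √‖(⟨fun t => inner ℂ (x t) (x t), by fun_prop⟩ : C(X, ℂ))‖ := by
        rw [ContinuousMap.norm_le _ (Real.sqrt_nonneg _)]
        intro t
        apply Real.le_sqrt_of_sq_le
        refine le_trans (le_of_eq ?_) (ContinuousMap.norm_coe_le_norm _ t)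
        simp [inner_self_eq_norm_sq_to_K]
      calc ‖x‖ * ‖x‖ ≤ _ := mul_self_le_mul_self (norm_nonneg _) h
        _ = _ := Real.mul_self_sqrt (norm_nonneg _)

@[simp]
theorem continuousMap_inner_apply [CompactSpace X] (x y : C(X, H)) (t : X) :
    (inner C(X, ℂ) x y) t = inner ℂ (x t) (y t) := rfl

/-- The functions that are pointwise orthogonal to a given, possibly discontinuous, vector
field. -/
def pointwiseOrthogonal (v : X → H) : Submodule C(X, ℂ) C(X, H) where
  carrier := {x | ∀ t, inner ℂ (v t) (x t) = 0}
  add_mem' {x y} hx hy t := by simp [hx t, hy t]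
  zero_mem' t := by simp
  smul_mem' a x hx t := by simp [hx t]

theorem mem_pointwiseOrthogonal {v : X → H} {x : C(X, H)} :
    x ∈ pointwiseOrthogonal v ↔ ∀ t, inner ℂ (v t) (x t) = 0 := Iff.rfl

/-- Each condition fixes one `t`, so continuity of `v` plays no role. -/
theorem isClosed_pointwiseOrthogonal (v : X → H) :
    IsClosed (pointwiseOrthogonal v : Set C(X, H)) := by
  have h : (pointwiseOrthogonal v : Set C(X, H)) =
      ⋂ t, {x : C(X, H) | inner ℂ (v t) (x t) = 0} := by
    ext x
    simp [mem_pointwiseOrthogonal]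
  rw [h]
  exact isClosed_iInter fun t => isClosed_eq
    (continuous_const.inner (ContinuousEvalConst.continuous_eval_const t)) continuous_const

end ContinuousMapModule

theorem isThick_iff {A N : Type*} [CommCStarAlgebra A] [PartialOrder A]
    [NormedAddCommGroup N] [NormedSpace ℂ N] [Module A N] [IsScalarTower ℂ A N]
    [CStarModule A N] (M : Submodule A N) :
    IsThick M ↔ ∀ n : N, (∀ m ∈ M, inner A n m = 0) → n = 0 := by
  refine ⟨fun h n hn => ?_, fun h => ?_⟩
  · have : n ∈ orthogonalComplement M := hn
    rwa [h] at this
  · refine Set.eq_singleton_iff_unique_mem.2 ⟨fun m _ => ?_, h⟩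
    exact CStarModule.inner_zero_left

/-! ### The discontinuous vector field and the counterexample -/

section Weights

/-- The square of the weight with index `(k, j)`: for `t` different from the `k`-th point of a
dense sequence these add up over `j` to `2⁻ᵏ`, and they vanish at that point. -/
noncomputable def weightSq (t : I) (p : ℕ × ℕ) : ℝ :=
  (1 / 2) ^ p.1 * ((1 - dist t (TopologicalSpace.denseSeq I p.1)) ^ p.2 *
    dist t (TopologicalSpace.denseSeq I p.1))

theorem dist_le_one_of_unitInterval (s t : I) : dist s t ≤ 1 := by
  rw [Subtype.dist_eq, Real.dist_eq, abs_le]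
  constructor <;> linarith [s.2.1, s.2.2, t.2.1, t.2.2]

theorem weightSq_nonneg (t : I) (p : ℕ × ℕ) : 0 ≤ weightSq t p := by
  have h := sub_nonneg.2 (dist_le_one_of_unitInterval t (TopologicalSpace.denseSeq I p.1))
  unfold weightSq
  positivity

theorem hasSum_weightSq {t : I} {k : ℕ} (h : t ≠ TopologicalSpace.denseSeq I k) :
    HasSum (fun j => weightSq t (k, j)) ((1 / 2) ^ k) := by
  have h0 := dist_pos.2 h
  have h1 := dist_le_one_of_unitInterval t (TopologicalSpace.denseSeq I k)
  have := ((hasSum_geometric_of_lt_one (sub_nonneg.2 h1) (by linarith)).mul_right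
    (dist t (TopologicalSpace.denseSeq I k))).mul_left ((1 / 2 : ℝ) ^ k)
  rwa [sub_sub_cancel, inv_mul_cancel₀ h0.ne', mul_one] at this

theorem weightSq_denseSeq (k j : ℕ) : weightSq (TopologicalSpace.denseSeq I k) (k, j) = 0 := by
  simp [weightSq]

theorem summable_weightSq (t : I) : Summable (weightSq t) := by
  have hk (k : ℕ) : Summable (fun j => weightSq t (k, j)) ∧
      ∑' j, weightSq t (k, j) ≤ (1 / 2) ^ k := by
    by_cases h : t = TopologicalSpace.denseSeq I k
    · subst h
      simp [weightSq_denseSeq, summable_zero]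
    · exact ⟨(hasSum_weightSq h).summable, (hasSum_weightSq h).tsum_eq.le⟩
  rw [summable_prod_of_nonneg fun p => weightSq_nonneg t p]
  exact ⟨fun k => (hk k).1, Summable.of_nonneg_of_le
    (fun k => tsum_nonneg fun j => weightSq_nonneg t _) (fun k => (hk k).2)
    summable_geometric_two⟩

/-- The coordinates of a vector field that is nowhere norm continuous. -/
noncomputable def weight (t : I) : Bool ⊕ ℕ × ℕ → ℝ :=
  -- Of the two constant coordinates, `false` is suppressed in `K`; `true` still recovers the
  -- multiplier there.
  Sum.elim (fun _ => 1) fun p => √(weightSq t p)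

theorem continuous_weight (i : Bool ⊕ ℕ × ℕ) : Continuous fun t => weight t i := by
  rcases i with b | p
  · exact continuous_const
  · simp only [weight, Sum.elim_inr, weightSq]
    fun_prop

theorem memℓp_weight (t : I) : Memℓp (fun i => (weight t i : ℂ)) 2 := by
  apply memℓp_gen
  apply Summable.sum
  · exact (hasSum_fintype _).summable
  · refine (summable_weightSq t).congr fun p => ?_
    simp [weight, Real.sq_sqrt (weightSq_nonneg t p)]

/-- The vector field with coordinates `weight`. -/
noncomputable def weightField (t : I) : lp (fun _ : Bool ⊕ ℕ × ℕ => ℂ) 2 :=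
  ⟨fun i => (weight t i : ℂ), memℓp_weight t⟩

@[simp]
theorem weightField_apply (t : I) (i : Bool ⊕ ℕ × ℕ) : weightField t i = (weight t i : ℂ) := rfl

/-- A continuous multiple of `weight`, even on the coordinates in `ℕ × ℕ` only, can be a norm
continuous field only if the multiplier vanishes. -/
theorem eq_zero_of_weight_mul (n : C(I, lp (fun _ : Bool ⊕ ℕ × ℕ => ℂ) 2)) (c : C(I, ℂ))
    (h : ∀ t p, n t (Sum.inr p) = weight t (Sum.inr p) * c t) : c = 0 := by
  suffices hq : ∀ k, c (TopologicalSpace.denseSeq I k) = 0 by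
    have := (TopologicalSpace.denseRange_denseSeq I).equalizer c.continuous
      (continuous_const (y := (0 : ℂ))) (funext hq)
    exact ContinuousMap.ext fun t => congrFun this t
  intro k
  set q := TopologicalSpace.denseSeq I k with hq
  -- The `k`-th block of `n` vanishes at `q` but has squared norm `2⁻ᵏ ‖c t‖²` at every other `t`;
  -- letting `t → q` forces `c q = 0`.
  have key : ∀ t, t ≠ q → (1 / 2) ^ k * ‖c t‖ ^ 2 ≤ ‖n t - n q‖ ^ 2 := by
    intro t ht
    refine hasSum_le_of_sum_le ((hasSum_weightSq ht).mul_right (‖c t‖ ^ 2)) fun s => ?_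
    have h2 := lp.sum_rpow_le_norm_rpow (p := 2) (by norm_num) (n t - n q)
      (s.map ⟨fun j => Sum.inr (k, j), fun a b hab => by simpa using hab⟩)
    simp only [Finset.sum_map, lp.coeFn_sub, Pi.sub_apply, ENNReal.toReal_ofNat,
      Real.rpow_ofNat] at h2
    refine le_trans (le_of_eq (Finset.sum_congr rfl fun j _ => ?_)) h2
    change _ = ‖n t (Sum.inr (k, j)) - n q (Sum.inr (k, j))‖ ^ 2
    simp [h, weight, hq, weightSq_denseSeq, mul_pow, Real.sq_sqrt (weightSq_nonneg t (k, j))]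
  have hne : (𝓝[≠] q).NeBot := inferInstance
  have hl : Tendsto (fun t => (1 / 2 : ℝ) ^ k * ‖c t‖ ^ 2) (𝓝[≠] q)
      (𝓝 ((1 / 2) ^ k * ‖c q‖ ^ 2)) :=
    (Continuous.tendsto (by fun_prop) q).mono_left nhdsWithin_le_nhds
  have hr : Tendsto (fun t => ‖n t - n q‖ ^ 2) (𝓝[≠] q) (𝓝 (‖n q - n q‖ ^ 2)) :=
    (Continuous.tendsto (f := fun t => ‖n t - n q‖ ^ 2) (by fun_prop) q).mono_left
      nhdsWithin_le_nhds
  have hle := le_of_tendsto_of_tendsto hl hr (eventually_mem_nhdsWithin.mono key)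
  have hpos : (0 : ℝ) < (1 / 2) ^ k := by positivity
  have : ‖c q‖ ^ 2 ≤ 0 := by
    by_contra! hc
    have := mul_pos hpos hc
    rw [sub_self, norm_zero] at hle
    linarith
  simpa using le_antisymm this (sq_nonneg _)

/-- The section `weight j • eᵢ - weight i • eⱼ`, pointwise orthogonal to `weightField`. -/
noncomputable def elementarySection (i j : Bool ⊕ ℕ × ℕ) :
    C(I, lp (fun _ : Bool ⊕ ℕ × ℕ => ℂ) 2) where
  toFun t := (weight t j : ℂ) • lp.single 2 i (1 : ℂ) - (weight t i : ℂ) • lp.single 2 j (1 : ℂ)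
  continuous_toFun := by
    have := continuous_weight i
    have := continuous_weight j
    fun_prop

theorem inner_elementarySection (x : lp (fun _ : Bool ⊕ ℕ × ℕ => ℂ) 2)
    (i j : Bool ⊕ ℕ × ℕ) (t : I) :
    inner ℂ x (elementarySection i j t) =
      weight t j * (starRingEnd ℂ) (x i) - weight t i * (starRingEnd ℂ) (x j) := by
  simp [elementarySection, lp.inner_single_right]

theorem elementarySection_mem (i j : Bool ⊕ ℕ × ℕ) :
    elementarySection i j ∈ pointwiseOrthogonal weightField := by
  intro t
  rw [inner_elementarySection]
  simp [mul_comm]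

/-- The reference coordinate has weight 1, so the multiplier is itself a coordinate of `n`, hence
continuous. -/
theorem apply_eq_of_inner_elementarySection {n : C(I, lp (fun _ : Bool ⊕ ℕ × ℕ => ℂ) 2)}
    {i : Bool ⊕ ℕ × ℕ} {b : Bool} (t : I)
    (h : inner C(I, ℂ) n (elementarySection i (Sum.inl b)) = 0) :
    n t i = weight t i * n t (Sum.inl b) := by
  have ht := DFunLike.congr_fun h t
  rw [continuousMap_inner_apply, inner_elementarySection] at ht
  have := congrArg (starRingEnd ℂ) ht
  simpa [weight, sub_eq_zero] using this

/-- A coordinate of a continuous field, as a continuous function. -/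
noncomputable def coordinate (n : C(I, lp (fun _ : Bool ⊕ ℕ × ℕ => ℂ) 2)) (i : Bool ⊕ ℕ × ℕ) :
    C(I, ℂ) where
  toFun t := n t i
  continuous_toFun := by
    have h : (fun t => n t i) = fun t => inner ℂ (lp.single 2 i (1 : ℂ)) (n t) := by
      funext t
      simp [lp.inner_single_left]
    rw [h]
    fun_prop

theorem isThick_pointwiseOrthogonal_weightField :
    IsThick (A := C(I, ℂ)) (pointwiseOrthogonal weightField) := by
  rw [isThick_iff]
  intro n hn
  have h (t i) : n t i = weight t i * n t (Sum.inl false) :=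
    apply_eq_of_inner_elementarySection t (hn _ (elementarySection_mem i _))
  have hc : coordinate n (Sum.inl false) = 0 := eq_zero_of_weight_mul n _ fun t p => h t _
  ext t i
  have h0 : n t (Sum.inl false) = 0 := DFunLike.congr_fun hc t
  rw [h, h0, mul_zero]
  rfl

/-- The constant section with value a basis vector. -/
noncomputable def basisSection : C(I, lp (fun _ : Bool ⊕ ℕ × ℕ => ℂ) 2) :=
  ContinuousMap.const I (lp.single 2 (Sum.inl false) 1)

theorem mem_pointwiseOrthogonal_basisSection {x : C(I, lp (fun _ : Bool ⊕ ℕ × ℕ => ℂ) 2)} :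
    x ∈ pointwiseOrthogonal basisSection ↔ ∀ t, x t (Sum.inl false) = 0 := by
  simp [mem_pointwiseOrthogonal, basisSection, lp.inner_single_left]

theorem isThick_submoduleOf_pointwiseOrthogonal :
    IsThick (A := C(I, ℂ)) (N := pointwiseOrthogonal weightField)
      ((pointwiseOrthogonal weightField ⊓ pointwiseOrthogonal basisSection).submoduleOf
        (pointwiseOrthogonal weightField)) := by
  rw [isThick_iff]
  rintro ⟨n, hnM⟩ hn
  -- For `i ≠ Sum.inl false` the test section has no `false` coordinate, so it lies in `K`.
  have h (t i) (hi : i ≠ Sum.inl false) : n t i = weight t i * n t (Sum.inl true) := by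
    refine apply_eq_of_inner_elementarySection t
      (hn ⟨elementarySection i _, elementarySection_mem i _⟩ ⟨elementarySection_mem i _, ?_⟩)
    refine mem_pointwiseOrthogonal_basisSection.2 fun t => ?_
    change (weight t (Sum.inl true) : ℂ) * lp.single (E := fun _ => ℂ) 2 i 1 (Sum.inl false) -
      (weight t i : ℂ) * lp.single (E := fun _ => ℂ) 2 (Sum.inl true) 1 (Sum.inl false) = 0
    rw [lp.single_apply_ne _ _ _ hi.symm, lp.single_apply_ne _ _ _ (by simp), mul_zero, mul_zero,
      sub_zero]
  have hc : coordinate n (Sum.inl true) = 0 := eq_zero_of_weight_mul n _ fun t p => h t _ (by simp)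
  have hz (t i) (hi : i ≠ Sum.inl false) : n t i = 0 := by
    have : n t (Sum.inl true) = 0 := DFunLike.congr_fun hc t
    rw [h t i hi, this, mul_zero]
  have hs (t) : n t = lp.single 2 (Sum.inl false) (n t (Sum.inl false)) := by
    ext i
    by_cases hi : i = Sum.inl false
    · subst hi
      simp
    · rw [hz t i hi, lp.single_apply_ne _ _ _ hi]
  have h0 (t) : n t (Sum.inl false) = 0 := by
    have := hnM t
    rw [hs t, lp.inner_single_right] at this
    simpa [weight] using this
  apply Subtype.ext
  refine ContinuousMap.ext fun t => ?_
  rw [hs t, h0 t]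
  simp

theorem not_isThick_inf_pointwiseOrthogonal_basisSection :
    ¬ IsThick (A := C(I, ℂ))
      (pointwiseOrthogonal weightField ⊓ pointwiseOrthogonal basisSection) := by
  rw [isThick_iff]
  intro h
  have h0 := h basisSection fun m hm => ContinuousMap.ext fun t => hm.2 t
  have := congrArg (fun f => f (0 : I) (Sum.inl false)) h0
  simp [basisSection] at this

end Weights

end HilbertModule

theorem mainTheorem6 :
    ∃ (N : Type) (_ : NormedAddCommGroup N) (_ : NormedSpace ℂ N)
      (_ : Module C(unitInterval, ℂ) N) (_ : IsScalarTower ℂ C(unitInterval, ℂ) N)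
      (_ : CStarModule C(unitInterval, ℂ) N) (_ : CompleteSpace N)
      (K M : Submodule C(unitInterval, ℂ) N),
      IsClosed (K : Set N) ∧ IsClosed (M : Set N) ∧ K ≤ M ∧
      HilbertModule.IsThick (A := C(unitInterval, ℂ)) (N := M) (K.submoduleOf M) ∧
      HilbertModule.IsThick (A := C(unitInterval, ℂ)) (N := N) M ∧
      ¬ HilbertModule.IsThick (A := C(unitInterval, ℂ)) (N := N) K := by
  exact ⟨C(unitInterval, lp (fun _ : Bool ⊕ ℕ × ℕ => ℂ) 2), inferInstance, inferInstance,
    inferInstance, inferInstance, inferInstance, inferInstance,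
    HilbertModule.pointwiseOrthogonal HilbertModule.weightField ⊓
      HilbertModule.pointwiseOrthogonal HilbertModule.basisSection,
    HilbertModule.pointwiseOrthogonal HilbertModule.weightField,
    (HilbertModule.isClosed_pointwiseOrthogonal _).inter
      (HilbertModule.isClosed_pointwiseOrthogonal _),
    HilbertModule.isClosed_pointwiseOrthogonal _, inf_le_left,
    HilbertModule.isThick_submoduleOf_pointwiseOrthogonal,
    HilbertModule.isThick_pointwiseOrthogonal_weightField,
    HilbertModule.not_isThick_inf_pointwiseOrthogonal_basisSection⟩
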